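/- For $k\ge 1$ and positive integers $d_1,\dots,d_k$, let $\mathbb{R}^{d_1\times\dots\times d_k}$ be the space of real $k$-way arrays (real tensors of order $k$). The outer product of $x_1\in\mathbb{R}^{d_1},\dots,x_k\in\mathbb{R}^{d_k}$ is the tensor $x_1\otimes\dots\otimes x_k$ with entries $(x_1)_{j_1}\cdots(x_k)_{j_k}$. The rank $\operatorname{rank}_\otimes(A)$ of a tensor $A$ is the least $m\ge 0$ such that $A$ is a sum of $m$ outer products of vectors. Given a norm $\lVert\cdot\rVert$ on $\mathbb{R}^{d_1\times\dots\times d_k}$, a best rank-$r$ approximation of $A$ is a tensor $B$ with $\operatorname{rank}_\otimes(B)\le r$ such that $\lVert A-B\rVert\le\lVert A-C\rVert$ for all tensors $C$ of the same format with $\operatorname{rank}_\otimes(C)\le r$. Let $s\ge 1$ and $r\ge 2s$ be integers. (1) There are $d_1,d_2,d_3$, a sequence $(B_n)$ in $\mathbb{R}^{d_1\times d_2\times d_3}$ and a tensor $B\in\mathbb{R}^{d_1\times d_2\times d_3}$ such that $\operatorname{rank}_\otimes(B_n)\le r$ for all $n$, $\lim_{n\to\infty}B_n=B$, and $\operatorname{rank}_\otimes(B)=r+s$.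 (2) For every $k\ge 3$ there are $d_1,\dots,d_k$ and a tensor $A\in\mathbb{R}^{d_1\times\dots\times d_k}$ such that $\operatorname{rank}_\otimes(A)=r+s$ and, for every norm on $\mathbb{R}^{d_1\times\dots\times d_k}$, $A$ has no best rank-$r$ approximation with respect to that norm. -/

import Mathlib

open scoped Topology

/-- Real hypermatrices of format `d 0 × ⋯ × d (k - 1)`, that is, real tensors of order `k`.
The topology is the product topology, which is the one induced by any norm. -/
abbrev RealTensor {k : ℕ} (d : Fin k → ℕ) : Type :=
  ((i : Fin k) → Fin (d i)) → ℝ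

namespace RealTensor

variable {k : ℕ} {d : Fin k → ℕ}

/-- The outer product `x 0 ⊗ ⋯ ⊗ x (k - 1)`, with entries
`x 0 (j 0) * ⋯ * x (k - 1) (j (k - 1))`. -/
def outer (x : (i : Fin k) → Fin (d i) → ℝ) : RealTensor d :=
  fun j => ∏ i, x i (j i)

/-- `A` is a sum of `m` decomposable tensors. -/
def IsSumOfDecomposables (A : RealTensor d) (m : ℕ) : Prop :=
  ∃ x : Fin m → (i : Fin k) → Fin (d i) → ℝ, A = ∑ l, outer (x l)

/-- The outer-product rank: the least number of decomposable tensors with sum `A`. -/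
noncomputable def rank (A : RealTensor d) : ℕ :=
  sInf {m : ℕ | A.IsSumOfDecomposables m}

/-- Every tensor of positive order is a finite sum of decomposable tensors, so that the minimum
in the definition of the rank is over a non-empty set. -/
theorem exists_isSumOfDecomposables (hk : 0 < k) (A : RealTensor d) :
    ∃ m : ℕ, A.IsSumOfDecomposables m := by
  classical
  let e := Fintype.equivFin ((i : Fin k) → Fin (d i))
  let i₀ : Fin k := ⟨0, hk⟩
  refine ⟨_, fun l i t =>
    (if i = i₀ then A (e.symm l) else 1) * (if t = e.symm l i then 1 else 0), ?_⟩
  funext j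
  rw [Finset.sum_apply, ← Equiv.sum_comp e, Finset.sum_eq_single j]
  · simp [outer]
  · intro b _ hb
    obtain ⟨i, hi⟩ := Function.ne_iff.mp hb
    exact Finset.prod_eq_zero (Finset.mem_univ i) (by simp [Ne.symm hi])
  · simp

/-- `B` is a best rank-`r` approximation of `A` with respect to `N`: it minimizes `N (A - C)`
over all tensors `C` of rank at most `r`. -/
def IsBestRankApprox (N : Seminorm ℝ (RealTensor d)) (r : ℕ) (A B : RealTensor d) : Prop :=
  B.rank ≤ r ∧ ∀ C : RealTensor d, C.rank ≤ r → N (A - B) ≤ N (A - C)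

end RealTensor

/-!
For a real algebra `𝒜` of dimension `r`, expanding the product in a basis of `𝒜` gives a tensor
of order three. Its rank is the least number of terms in an expression
`x * y = ∑ l, (f l x * g l y) • c l` with linear forms `f l`, `g l` and vectors `c l`. Take
`𝒜 = ℝ[ε] ^ s × ℝ ^ t` with `2 * s + t = r`.

Deforming `ε ^ 2 = 0` to `ε ^ 2 = δ • ε` with `δ ≠ 0` turns each copy of `ℝ[ε]` into an algebra
isomorphic to `ℝ × ℝ`, and the whole algebra into `ℝ ^ r`, whose product needs only `r` terms.
Letting `δ` tend to zero, the tensor of `𝒜` is a limit of tensors of rank at most `r`.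

The tensor of `𝒜` itself has rank `3 * s + t = r + s`. The lower bound is the substitution method:
the vectors `1 + n`, with `n` in the `s`-dimensional nilradical, are units, and among them there is
one that is annihilated by `s` of the linear forms `f l`. Multiplication by it is injective and only
involves the remaining terms, so there are at least `r` of them.

A factor `v ⊗` with `v ≠ 0` changes neither ranks nor limits, which gives the higher orders.
-/

open Module
open scoped DualNumber

section Substitution

variable {K V W U ι : Type*} [Field K] [AddCommGroup V] [Module K V] [AddCommGroup W] [Module K W]
  [AddCommGroup U] [Module K U]

theorem exists_finset_card_eq_finrank_forall_exists_eqOn [Finite ι] {F : V →ₗ[K] ι → K}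
    (hF : Function.Injective F) :
    ∃ S : Finset ι, S.card = finrank K V ∧ ∀ y : ι → K, ∃ v, Set.EqOn (F v) y S := by
  classical
  have := Fintype.ofFinite ι
  -- Keep all coordinates but some whose unit vectors form a basis of the cokernel of `F`.
  let e (i : ι) : (ι → K) ⧸ F.range := F.range.mkQ (Pi.single i 1)
  obtain ⟨κ, a, ha, hspan, hli⟩ := exists_linearIndependent' K e
  have := Fintype.ofInjective a ha
  have htop : Submodule.span K (Set.range (e ∘ a)) = ⊤ := by
    rw [hspan, show e = F.range.mkQ ∘ Pi.basisFun K ι by ext; simp [e], Set.range_comp,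
      Submodule.span_image, Basis.span_eq, Submodule.map_top, Submodule.range_mkQ]
  have hcard : Fintype.card κ + finrank K V = Fintype.card ι := by
    rw [← finrank_span_eq_card hli, htop, finrank_top, ← LinearMap.finrank_range_of_inj hF,
      Submodule.finrank_quotient_add_finrank, finrank_fintype_fun_eq_card]
  refine ⟨(Finset.univ.image a)ᶜ, ?_, fun y => ?_⟩
  · rw [Finset.card_compl, Finset.card_image_of_injective _ ha, Finset.card_univ]
    omega
  · obtain ⟨z, hz⟩ := (Submodule.mem_span_range_iff_exists_fun K).1
      (htop ▸ Submodule.mem_top : F.range.mkQ y ∈ Submodule.span K (Set.range (e ∘ a)))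
    obtain ⟨v, hv⟩ : y - ∑ q, z q • Pi.single (a q) 1 ∈ F.range := by
      rw [← Submodule.ker_mkQ F.range, LinearMap.mem_ker, map_sub, map_sum, ← hz]
      simp [e]
    refine ⟨v, fun i hi => ?_⟩
    have hne (q : κ) : i ≠ a q := by rintro rfl; simp at hi
    simp [hv, hne]

/-- The bilinear map `(x, y) ↦ (f x * g y) • c`. Sums of `m` such maps correspond to tensors of
order three and rank at most `m`. -/
def rankOneBilin (f : Dual K V) (g : Dual K W) (c : U) : V →ₗ[K] W →ₗ[K] U :=
  f.smulRight (g.smulRight c)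

@[simp]
theorem rankOneBilin_apply (f : Dual K V) (g : Dual K W) (c : U) (x : V) (y : W) :
    rankOneBilin f g c x y = f x • g y • c :=
  rfl

variable [Fintype ι]

theorem sum_rankOneBilin_apply (f : ι → Dual K V) (g : ι → Dual K W) (c : ι → U) (x : V) (y : W) :
    (∑ l, rankOneBilin (f l) (g l) (c l)) x y = ∑ l, f l x • g l y • c l := by
  simp

theorem finrank_add_finrank_le_card_of_eq_sum_rankOneBilin {β : V →ₗ[K] W →ₗ[K] U}
    {f : ι → Dual K V} {g : ι → Dual K W} {c : ι → U}
    (hβ : β = ∑ l, rankOneBilin (f l) (g l) (c l)) {N : Submodule K V} {v : V}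
    (hN : Disjoint N (LinearMap.ker β)) (hv : ∀ n ∈ N, Function.Injective (β (v + n))) :
    finrank K N + finrank K W ≤ Fintype.card ι := by
  classical
  have hinjN : Function.Injective (LinearMap.pi f ∘ₗ N.subtype) := by
    refine (injective_iff_map_eq_zero _).2 fun n hn => ?_
    have hf (l : ι) : f l n = 0 := congrFun hn l
    refine Subtype.ext (Submodule.disjoint_def.1 hN n n.2 ?_)
    ext y
    simp [hβ, hf]
  obtain ⟨S, hS, hsurj⟩ := exists_finset_card_eq_finrank_forall_exists_eqOn hinjN
  obtain ⟨n, hn⟩ := hsurj fun l => -f l v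
  have hf (l : ι) (hl : l ∈ S) : f l (v + n) = 0 := by
    rw [map_add, show f l n = -f l v from hn hl, add_neg_cancel]
  have hinjW : Function.Injective (LinearMap.pi fun l : {l // l ∉ S} => g l) := by
    refine (injective_iff_map_eq_zero _).2 fun y hy => hv n n.2 ?_
    rw [map_zero, hβ, sum_rankOneBilin_apply]
    refine Finset.sum_eq_zero fun l _ => ?_
    by_cases hl : l ∈ S
    · rw [hf l hl, zero_smul]
    · rw [show g l y = 0 from congrFun hy ⟨l, hl⟩, zero_smul, smul_zero]
  have hW := LinearMap.finrank_le_finrank_of_injective hinjW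
  rw [finrank_fintype_fun_eq_card, Fintype.card_subtype_compl, Fintype.card_coe] at hW
  have := S.card_le_univ
  omega

theorem finrank_add_finrank_le_card_of_mul_eq_sum_rankOneBilin {𝒜 : Type*} [Ring 𝒜] [Algebra K 𝒜]
    {f g : ι → Dual K 𝒜} {c : ι → 𝒜}
    (hmul : LinearMap.mul K 𝒜 = ∑ l, rankOneBilin (f l) (g l) (c l)) {N : Submodule K 𝒜}
    (hN : ∀ n ∈ N, IsUnit (1 + n)) :
    finrank K N + finrank K 𝒜 ≤ Fintype.card ι := by
  refine finrank_add_finrank_le_card_of_eq_sum_rankOneBilin hmul (v := 1) ?_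
    fun n hn => (hN n hn).mul_right_injective
  rw [LinearMap.ker_eq_bot'.2 fun a ha => by simpa using LinearMap.congr_fun ha 1]
  exact disjoint_bot_right

end Substitution

section DualNumbers

variable (K : Type*) [Field K] (s t : ℕ)

/-- The algebra `K[ε] ^ s × K ^ t`, whose product expands to the tensor of the rank jump. -/
abbrev DualNumberProd : Type _ :=
  (Fin s → K[ε]) × (Fin t → K)

namespace DualNumberProd

instance : FiniteDimensional K K[ε] :=
  inferInstanceAs (FiniteDimensional K (K × K))

theorem finrank_dualNumber : finrank K K[ε] = 2 :=
  (finrank_prod (R := K) (M := K) (M' := K)).trans (by simp)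

theorem finrank_eq : finrank K (DualNumberProd K s t) = 2 * s + t := by
  simp [finrank_prod, finrank_pi_fintype, finrank_dualNumber, mul_comm]

variable {K s t}

/-- The coefficient of `1` in the `i`-th dual number. -/
def re (i : Fin s) : Dual K (DualNumberProd K s t) :=
  (TrivSqZeroExt.fstHom K K K).toLinearMap ∘ₗ LinearMap.proj i ∘ₗ LinearMap.fst K _ _

/-- The coefficient of `ε` in the `i`-th dual number. -/
def im (i : Fin s) : Dual K (DualNumberProd K s t) :=
  TrivSqZeroExt.sndHom K K ∘ₗ LinearMap.proj i ∘ₗ LinearMap.fst K _ _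

/-- The `i`-th coordinate of the component in `K ^ t`. -/
def coord (i : Fin t) : Dual K (DualNumberProd K s t) :=
  LinearMap.proj i ∘ₗ LinearMap.snd K _ _

/-- The dual number `a` in the `i`-th factor. -/
def single (i : Fin s) (a : K[ε]) : DualNumberProd K s t := (Pi.single i a, 0)

@[simp] theorem re_apply (i : Fin s) (x : DualNumberProd K s t) : re i x = (x.1 i).fst := rfl
@[simp] theorem im_apply (i : Fin s) (x : DualNumberProd K s t) : im i x = (x.1 i).snd := rfl
@[simp] theorem coord_apply (i : Fin t) (x : DualNumberProd K s t) : coord i x = x.2 i := rfl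

theorem ext {x y : DualNumberProd K s t} (hre : ∀ i, re i x = re i y)
    (him : ∀ i, im i x = im i y) (hcoord : ∀ i, coord i x = coord i y) : x = y :=
  Prod.ext (funext fun i => TrivSqZeroExt.ext (hre i) (him i)) (funext hcoord)

theorem mul_eq_sum_rankOneBilin : LinearMap.mul K (DualNumberProd K s t) =
    ∑ i, (rankOneBilin (re i) (re i) (single i 1) + rankOneBilin (re i) (im i) (single i ε) +
        rankOneBilin (im i) (re i) (single i ε)) +
      ∑ i, rankOneBilin (coord i) (coord i) (0, Pi.single i 1) := by
  refine LinearMap.ext₂ fun x y => ext ?_ ?_ ?_ <;> intro i <;>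
    simp [single, Prod.fst_sum, Prod.snd_sum, Finset.sum_add_distrib, Pi.single_apply]

/-- The derivative in `δ` of the product of `K[ε] ^ s × K ^ t` when `ε ^ 2 = 0` is deformed to
`ε ^ 2 = δ • ε` in each dual number. -/
def mulDeformation (K : Type*) [Field K] (s t : ℕ) :
    DualNumberProd K s t →ₗ[K] DualNumberProd K s t →ₗ[K] DualNumberProd K s t :=
  ∑ i, rankOneBilin (im i) (im i) (single i ε)

-- `δ⁻¹ • ε` and `1 - δ⁻¹ • ε` are the two idempotents of the deformed algebra of dual numbers.
theorem mul_add_smul_mulDeformation {δ : K} (hδ : δ ≠ 0) :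
    LinearMap.mul K (DualNumberProd K s t) + δ • mulDeformation K s t =
      ∑ i, (rankOneBilin (re i) (re i) (single i (1 - δ⁻¹ • ε)) +
        rankOneBilin (re i + δ • im i) (re i + δ • im i) (single i (δ⁻¹ • ε))) +
      ∑ i, rankOneBilin (coord i) (coord i) (0, Pi.single i 1) := by
  have him (a b c d : K) : a * d + b * c + δ * (b * d) =
      -(a * (c * δ⁻¹)) + (a + δ * b) * ((c + δ * d) * δ⁻¹) := by
    field_simp
    ring
  refine LinearMap.ext₂ fun x y => ext ?_ ?_ ?_ <;> intro i <;>
    simp [mulDeformation, single, Prod.fst_sum, Prod.snd_sum, Finset.sum_add_distrib,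
      Pi.single_apply, him]

variable (K s t) in
/-- The square-zero elements with vanishing component in `K ^ t`, that is, the nilradical. -/
def nilpotents : Submodule K (DualNumberProd K s t) :=
  LinearMap.range (LinearMap.inl K _ _ ∘ₗ (TrivSqZeroExt.inrHom K K).compLeft (Fin s))

theorem finrank_nilpotents : finrank K (nilpotents K s t) = s := by
  rw [nilpotents, LinearMap.finrank_range_of_inj, finrank_fin_fun]
  exact LinearMap.inl_injective.comp TrivSqZeroExt.inr_injective.comp_left

theorem isNilpotent_of_mem_nilpotents {n : DualNumberProd K s t} (hn : n ∈ nilpotents K s t) :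
    IsNilpotent n := by
  obtain ⟨a, rfl⟩ := hn
  refine ⟨2, ?_⟩
  rw [sq]
  exact Prod.ext (funext fun i => TrivSqZeroExt.inr_mul_inr K (a i) (a i)) (mul_zero _)

theorem le_card_of_mul_eq_sum_rankOneBilin {ι : Type*} [Fintype ι]
    {f g : ι → Dual K (DualNumberProd K s t)} {c : ι → DualNumberProd K s t}
    (hmul : LinearMap.mul K (DualNumberProd K s t) = ∑ l, rankOneBilin (f l) (g l) (c l)) :
    3 * s + t ≤ Fintype.card ι := by
  have h := finrank_add_finrank_le_card_of_mul_eq_sum_rankOneBilin hmul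
    (N := nilpotents K s t) fun n hn => (isNilpotent_of_mem_nilpotents hn).isUnit_one_add
  rw [finrank_nilpotents, finrank_eq] at h
  omega

end DualNumberProd

end DualNumbers

namespace RealTensor

section Rank

variable {k : ℕ} {d : Fin k → ℕ}

theorem isSumOfDecomposables_outer (x : (i : Fin k) → Fin (d i) → ℝ) :
    (outer x).IsSumOfDecomposables 1 :=
  ⟨fun _ => x, by simp⟩

theorem IsSumOfDecomposables.add {A B : RealTensor d} {m n : ℕ}
    (hA : A.IsSumOfDecomposables m) (hB : B.IsSumOfDecomposables n) :
    (A + B).IsSumOfDecomposables (m + n) := by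
  obtain ⟨x, rfl⟩ := hA
  obtain ⟨y, rfl⟩ := hB
  exact ⟨Fin.append x y, by simp [Fin.sum_univ_add]⟩

theorem IsSumOfDecomposables.sum {n m : ℕ} {A : Fin n → RealTensor d}
    (hA : ∀ i, (A i).IsSumOfDecomposables m) : (∑ i, A i).IsSumOfDecomposables (n * m) := by
  choose x hx using hA
  refine ⟨fun l => x (finProdFinEquiv.symm l).1 (finProdFinEquiv.symm l).2, ?_⟩
  rw [finProdFinEquiv.symm.sum_comp fun l => outer (x l.1 l.2), Fintype.sum_prod_type]
  exact Finset.sum_congr rfl fun i _ => hx i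

theorem exists_outer_eq_smul_outer (hk : 0 < k) (a : ℝ) (x : (i : Fin k) → Fin (d i) → ℝ) :
    ∃ y : (i : Fin k) → Fin (d i) → ℝ, a • outer x = outer y := by
  refine ⟨fun i => (if i = ⟨0, hk⟩ then a else 1) • x i, funext fun j => ?_⟩
  simp only [outer, Pi.smul_apply, smul_eq_mul, Finset.prod_mul_distrib, Finset.prod_ite_eq',
    Finset.mem_univ, if_true]

theorem IsSumOfDecomposables.smul (hk : 0 < k) {A : RealTensor d} {m : ℕ}
    (hA : A.IsSumOfDecomposables m) (a : ℝ) : (a • A).IsSumOfDecomposables m := by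
  obtain ⟨x, rfl⟩ := hA
  choose y hy using fun l => exists_outer_eq_smul_outer hk a (x l)
  exact ⟨y, by simp only [Finset.smul_sum, hy]⟩

theorem IsSumOfDecomposables.rank_le {A : RealTensor d} {m : ℕ}
    (hA : A.IsSumOfDecomposables m) : A.rank ≤ m :=
  Nat.sInf_le hA

theorem isSumOfDecomposables_rank (hk : 0 < k) (A : RealTensor d) :
    A.IsSumOfDecomposables A.rank :=
  Nat.sInf_mem (exists_isSumOfDecomposables hk A)

theorem not_exists_isBestRankApprox_of_mem_closure {r : ℕ} {A : RealTensor d}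
    (hA : A ∈ closure {B | B.rank ≤ r}) (hr : r < A.rank)
    {N : Seminorm ℝ (RealTensor d)} (hN : ∀ C, N C = 0 → C = 0) :
    ¬ ∃ B, IsBestRankApprox N r A B := by
  rintro ⟨B, hB, hmin⟩
  have hcont : Continuous N := continuousOn_univ.1 (N.convexOn.continuousOn isOpen_univ)
  have hle : N (A - B) ≤ N (A - A) :=
    closure_minimal (t := {C | N (A - B) ≤ N (A - C)}) hmin
      (isClosed_le continuous_const (hcont.comp (continuous_const.sub continuous_id))) hA
  have hAB : A = B := sub_eq_zero.1 <| hN _ <| (hle.trans_eq (by simp)).antisymm (apply_nonneg N _)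
  exact hr.not_ge (hAB ▸ hB)

end Rank

section ConsOuter

variable {k : ℕ} {d : Fin (k + 1) → ℕ}

/-- The outer product `v ⊗ A` of a vector and a tensor. -/
def consOuter (v : Fin (d 0) → ℝ) : RealTensor (Fin.tail d) →ₗ[ℝ] RealTensor d where
  toFun A j := v (j 0) * A (Fin.tail j)
  map_add' _ _ := funext fun _ => mul_add _ _ _
  map_smul' _ _ := funext fun _ => mul_left_comm _ _ _

/-- The tensor of order `k` obtained by fixing the first index to be `a`. -/
def slice (a : Fin (d 0)) : RealTensor d →ₗ[ℝ] RealTensor (Fin.tail d) where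
  toFun A j := A (Fin.cons (α := fun i => Fin (d i)) a j)
  map_add' _ _ := rfl
  map_smul' _ _ := rfl

theorem slice_consOuter (v : Fin (d 0) → ℝ) (a : Fin (d 0)) (A : RealTensor (Fin.tail d)) :
    slice a (consOuter v A) = v a • A :=
  rfl

theorem consOuter_outer (v : Fin (d 0) → ℝ) (x : (i : Fin k) → Fin (Fin.tail d i) → ℝ) :
    consOuter v (outer x) = outer (Fin.cons (α := fun i => Fin (d i) → ℝ) v x) :=
  funext fun j =>
    (Fin.prod_univ_succ fun i => Fin.cons (α := fun i => Fin (d i) → ℝ) v x i (j i)).symm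

theorem slice_outer (a : Fin (d 0)) (x : (i : Fin (k + 1)) → Fin (d i) → ℝ) :
    slice a (outer x) = x 0 a • outer (d := Fin.tail d) (Fin.tail x) :=
  funext fun _ => Fin.prod_univ_succ _

theorem IsSumOfDecomposables.consOuter {A : RealTensor (Fin.tail d)} {m : ℕ}
    (hA : A.IsSumOfDecomposables m) (v : Fin (d 0) → ℝ) :
    (consOuter v A).IsSumOfDecomposables m := by
  obtain ⟨x, rfl⟩ := hA
  refine ⟨fun l => Fin.cons (α := fun i => Fin (d i) → ℝ) v (x l), ?_⟩
  rw [map_sum]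
  exact Finset.sum_congr rfl fun l _ => consOuter_outer v (x l)

theorem IsSumOfDecomposables.slice (hk : 0 < k) {A : RealTensor d} {m : ℕ}
    (hA : A.IsSumOfDecomposables m) (a : Fin (d 0)) : (slice a A).IsSumOfDecomposables m := by
  obtain ⟨x, rfl⟩ := hA
  choose y hy using fun l =>
    exists_outer_eq_smul_outer (d := Fin.tail d) hk (x l 0 a) (Fin.tail (x l))
  exact ⟨y, by simp only [map_sum, slice_outer, hy]⟩

theorem rank_consOuter (hk : 0 < k) {v : Fin (d 0) → ℝ} (hv : v ≠ 0)
    (A : RealTensor (Fin.tail d)) : (consOuter v A).rank = A.rank := by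
  obtain ⟨a, ha⟩ := Function.ne_iff.1 hv
  refine ((isSumOfDecomposables_rank hk A).consOuter v).rank_le.antisymm ?_
  have h := ((isSumOfDecomposables_rank k.succ_pos (consOuter v A)).slice hk a).smul hk (v a)⁻¹
  rw [slice_consOuter, inv_smul_smul₀ ha] at h
  exact h.rank_le

theorem consOuter_mem_closure (hk : 0 < k) {r : ℕ} {A : RealTensor (Fin.tail d)}
    (hA : A ∈ closure {B | B.rank ≤ r}) (v : Fin (d 0) → ℝ) :
    consOuter v A ∈ closure {B | B.rank ≤ r} :=
  map_mem_closure (consOuter v).continuous_of_finiteDimensional hA fun B hB =>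
    ((isSumOfDecomposables_rank hk B).consOuter v).rank_le.trans hB

end ConsOuter

section OfBilin

variable {d : Fin 3 → ℕ} {V W U : Type*} [AddCommGroup V] [Module ℝ V] [AddCommGroup W]
  [Module ℝ W] [AddCommGroup U] [Module ℝ U] (b₀ : Basis (Fin (d 0)) ℝ V)
  (b₁ : Basis (Fin (d 1)) ℝ W) (b₂ : Basis (Fin (d 2)) ℝ U)

/-- The tensor of structure constants of a bilinear map `V × W → U` with respect to bases of the
three spaces. -/
noncomputable def ofBilin : (V →ₗ[ℝ] W →ₗ[ℝ] U) →ₗ[ℝ] RealTensor d where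
  toFun β j := b₂.repr (β (b₀ (j 0)) (b₁ (j 1))) (j 2)
  map_add' _ _ := funext fun _ => by simp
  map_smul' _ _ := funext fun _ => by simp

theorem ofBilin_injective : Function.Injective (ofBilin b₀ b₁ b₂) := fun _ _ h =>
  b₀.ext fun i => b₁.ext fun j => b₂.repr.injective <| Finsupp.ext fun l =>
    congrFun h fun | 0 => i | 1 => j | 2 => l

theorem ofBilin_rankOneBilin (f : Dual ℝ V) (g : Dual ℝ W) (c : U) :
    ofBilin b₀ b₁ b₂ (rankOneBilin f g c) =
      outer (d := d) fun | 0 => f ∘ b₀ | 1 => g ∘ b₁ | 2 => b₂.repr c :=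
  funext fun j => by simp [ofBilin, outer, Fin.prod_univ_three, mul_assoc]

theorem isSumOfDecomposables_ofBilin_rankOneBilin (f : Dual ℝ V) (g : Dual ℝ W) (c : U) :
    (ofBilin b₀ b₁ b₂ (rankOneBilin f g c)).IsSumOfDecomposables 1 :=
  ofBilin_rankOneBilin b₀ b₁ b₂ f g c ▸ isSumOfDecomposables_outer _

theorem outer_eq_ofBilin (x : (i : Fin 3) → Fin (d i) → ℝ) :
    outer x = ofBilin b₀ b₁ b₂ (rankOneBilin (b₀.constr ℝ (x 0)) (b₁.constr ℝ (x 1))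
      (b₂.equivFun.symm (x 2))) :=
  funext fun j => by
    simp [ofBilin, outer, Fin.prod_univ_three, mul_assoc, ← Basis.equivFun_apply]

theorem exists_eq_sum_rankOneBilin (β : V →ₗ[ℝ] W →ₗ[ℝ] U) :
    ∃ (f : Fin (ofBilin b₀ b₁ b₂ β).rank → Dual ℝ V)
      (g : Fin (ofBilin b₀ b₁ b₂ β).rank → Dual ℝ W) (c : Fin (ofBilin b₀ b₁ b₂ β).rank → U),
      β = ∑ l, rankOneBilin (f l) (g l) (c l) := by
  obtain ⟨x, hx⟩ := isSumOfDecomposables_rank three_pos (ofBilin b₀ b₁ b₂ β)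
  refine ⟨fun l => b₀.constr ℝ (x l 0), fun l => b₁.constr ℝ (x l 1),
    fun l => b₂.equivFun.symm (x l 2), ofBilin_injective b₀ b₁ b₂ (hx.trans ?_)⟩
  rw [map_sum]
  exact Finset.sum_congr rfl fun l _ => outer_eq_ofBilin b₀ b₁ b₂ (x l)

end OfBilin

section DualNumberTensor

open DualNumberProd

variable {s t r : ℕ} (b : Basis (Fin r) ℝ (DualNumberProd ℝ s t))

/-- The tensor of structure constants of the algebra `ℝ[ε] ^ s × ℝ ^ t`. -/
noncomputable def dualNumberTensor : RealTensor fun _ : Fin 3 => r :=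
  ofBilin b b b (LinearMap.mul ℝ _)

theorem rank_dualNumberTensor : (dualNumberTensor b).rank = 3 * s + t := by
  refine le_antisymm ?_ ?_
  · have h := isSumOfDecomposables_ofBilin_rankOneBilin (d := fun _ => r) b b b
    rw [dualNumberTensor, mul_eq_sum_rankOneBilin, map_add, map_sum, map_sum]
    simp only [map_add]
    refine ((IsSumOfDecomposables.sum fun _ => ((h _ _ _).add (h _ _ _)).add (h _ _ _)).add
      (IsSumOfDecomposables.sum fun _ => h _ _ _)).rank_le.trans_eq (by ring)
  · obtain ⟨f, g, c, hmul⟩ := exists_eq_sum_rankOneBilin (d := fun _ => r) b b b (LinearMap.mul ℝ _)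
    exact (le_card_of_mul_eq_sum_rankOneBilin hmul).trans_eq (Fintype.card_fin _)

theorem rank_dualNumberTensor_add_smul_le {δ : ℝ} (hδ : δ ≠ 0) :
    (dualNumberTensor b + δ • ofBilin (d := fun _ => r) b b b (mulDeformation ℝ s t)).rank ≤
      2 * s + t := by
  have h := isSumOfDecomposables_ofBilin_rankOneBilin (d := fun _ => r) b b b
  rw [dualNumberTensor, ← map_smul, ← map_add, mul_add_smul_mulDeformation hδ, map_add, map_sum,
    map_sum]
  simp only [map_add]
  refine ((IsSumOfDecomposables.sum fun _ => (h _ _ _).add (h _ _ _)).add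
    (IsSumOfDecomposables.sum fun _ => h _ _ _)).rank_le.trans_eq (by ring)

theorem dualNumberTensor_mem_closure :
    dualNumberTensor b ∈ closure {B | B.rank ≤ 2 * s + t} := by
  let T (δ : ℝ) := dualNumberTensor b + δ • ofBilin (d := fun _ => r) b b b (mulDeformation ℝ s t)
  have hlim : Filter.Tendsto T (𝓝[≠] 0) (𝓝 (dualNumberTensor b)) := by
    have : Continuous T := by fun_prop
    simpa [T] using (this.tendsto 0).mono_left nhdsWithin_le_nhds
  exact mem_closure_of_tendsto hlim
    (eventually_mem_nhdsWithin.mono fun δ hδ => rank_dualNumberTensor_add_smul_le b hδ)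

end DualNumberTensor

theorem exists_mem_closure_rank_eq {s r k : ℕ} (hr : 2 * s ≤ r) (hk : 3 ≤ k) :
    ∃ (d : Fin k → ℕ) (A : RealTensor d), A ∈ closure {B | B.rank ≤ r} ∧ A.rank = r + s := by
  induction k, hk using Nat.le_induction with
  | base =>
    obtain ⟨t, rfl⟩ := Nat.exists_eq_add_of_le hr
    let b := finBasisOfFinrankEq ℝ _ (DualNumberProd.finrank_eq ℝ s t)
    exact ⟨_, dualNumberTensor b, dualNumberTensor_mem_closure b,
      (rank_dualNumberTensor b).trans (by ring)⟩
  | succ k hk ih =>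
    obtain ⟨d, A, hA, hrank⟩ := ih
    have hpos : 0 < k := by omega
    have hv : (1 : Fin 1 → ℝ) ≠ 0 := one_ne_zero
    refine ⟨Fin.cons 1 d, consOuter (d := Fin.cons 1 d) 1 A, consOuter_mem_closure hpos hA 1, ?_⟩
    rw [← hrank]
    exact rank_consOuter hpos (d := Fin.cons 1 d) hv A

end RealTensor

theorem proposition4p11 (s r : ℕ) (hs : 1 ≤ s) (hr : 2 * s ≤ r) :
    (∃ (d : Fin 3 → ℕ) (B : ℕ → RealTensor d) (B' : RealTensor d),
      (∀ n, (B n).rank ≤ r) ∧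
      Filter.Tendsto B Filter.atTop (𝓝 B') ∧
      B'.rank = r + s) ∧
    (∀ k : ℕ, 3 ≤ k →
      ∃ (d : Fin k → ℕ) (A : RealTensor d),
        A.rank = r + s ∧
        -- `N` ranges over all norms, that is, over the seminorms that vanish only at zero
        ∀ N : Seminorm ℝ (RealTensor d), (∀ C : RealTensor d, N C = 0 → C = 0) →
          ¬ ∃ B : RealTensor d, RealTensor.IsBestRankApprox N r A B) := by
  refine ⟨?_, fun k hk => ?_⟩
  · obtain ⟨d, A, hA, hrank⟩ := RealTensor.exists_mem_closure_rank_eq hr le_rfl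
    obtain ⟨B, hB, hlim⟩ := mem_closure_iff_seq_limit.1 hA
    exact ⟨d, B, A, hB, hlim, hrank⟩
  · obtain ⟨d, A, hA, hrank⟩ := RealTensor.exists_mem_closure_rank_eq hr hk
    exact ⟨d, A, hrank, fun N hN =>
      RealTensor.not_exists_isBestRankApprox_of_mem_closure hA (by omega) hN⟩
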